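/- Let $\mathfrak H_0,\mathfrak H_1$ be complex separable Hilbert spaces with $\dim\mathfrak H_1<\infty$, let $A_0\in\mathcal L(\mathfrak H_0)$ and $A_1\in\mathcal L(\mathfrak H_1)$ be bounded self-adjoint operators and $V\in\mathcal L(\mathfrak H_1,\mathfrak H_0)$. Assume that $\operatorname{Ran}V$ is a cyclic generating subspace for $A_0$, i.e. that $$\operatorname{span}\{A_0^k v : k\in\mathbb N_0,\ v\in\operatorname{Ran}V\}$$ is dense in $\mathfrak H_0$. Let $$B=\begin{pmatrix}A_0&V\\ V^*&A_1\end{pmatrix}\quad\text{on }\mathfrak H=\mathfrak H_0\oplus\mathfrak H_1,$$ let $\mathsf E_B$ be the projection-valued spectral measure of the bounded self-adjoint operator $B$, let $J:\mathfrak H_1\to\mathfrak H$ be the inclusion map $y\mapsto(0,y)$, and for $z\in\mathbb C_+=\{z\in\mathbb C:\operatorname{Im}z>0\}$ put $$m(z)=\operatorname{tr}\bigl(J^*(B-z)^{-1}J\bigr).$$ Then $m$ is a scalar Herglotz function, i.e. $m$ is holomorphic on $\mathbb C_+$ and $\operatorname{Im}m(z)\ge 0$ for all $z\in\mathbb C_+$.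 Moreover, there is a finite positive Borel measure $\omega$ on $\mathbb R$ with compact support such that $$m(z)=\int_{\mathbb R}\frac{1}{t-z}\,d\omega(t)\qquad\text{for all }z\in\mathbb C_+,$$ and such that $\omega$ and $\mathsf E_B$ have the same null sets: for every Borel set $\Delta\subset\mathbb R$, $\omega(\Delta)=0$ if and only if $\mathsf E_B(\Delta)=0$. -/

import Mathlib

open MeasureTheory
open scoped InnerProductSpace BoundedContinuousFunction NNReal

noncomputable section

section SpectralMeasure

variable {H : Type*} [NormedAddCommGroup H] [InnerProductSpace ℂ H] [CompleteSpace H]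

/-- A projection-valued measure on the Borel sets of `ℝ`: the values are orthogonal projections,
`ℝ` has value `1`, and the measure is countably additive in the strong operator topology. -/
structure ProjectionValuedMeasure (H : Type*) [NormedAddCommGroup H] [InnerProductSpace ℂ H]
    [CompleteSpace H] where
  toFun : Set ℝ → H →L[ℂ] H
  isStarProjection : ∀ Δ, MeasurableSet Δ → IsStarProjection (toFun Δ)
  univ : toFun Set.univ = 1
  hasSum : ∀ A : ℕ → Set ℝ, (∀ i, MeasurableSet (A i)) → Pairwise (fun i j => Disjoint (A i) (A j)) →
    ∀ x : H, HasSum (fun i => toFun (A i) x) (toFun (⋃ i, A i) x)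

/-- The positive functional `f ↦ ⟪x, f(T) x⟫` on the continuous functions on the spectrum. -/
def spectralFunctional {T : H →L[ℂ] H} (hT : IsSelfAdjoint T) (x : H) :
    CompactlySupportedContinuousMap (spectrum ℝ T) ℝ →ₚ[ℝ] ℝ :=
  PositiveLinearMap.mk₀
    { toFun := fun f => (⟪x, cfcHom hT (f : C(spectrum ℝ T, ℝ)) x⟫_ℂ).re
      map_add' := fun f g => by
        have : ((f + g : CompactlySupportedContinuousMap (spectrum ℝ T) ℝ) :
          C(spectrum ℝ T, ℝ)) = (f : C(spectrum ℝ T, ℝ)) + (g : C(spectrum ℝ T, ℝ)) := rfl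
        rw [this, map_add]; simp
      map_smul' := fun c f => by
        have : ((c • f : CompactlySupportedContinuousMap (spectrum ℝ T) ℝ) :
          C(spectrum ℝ T, ℝ)) = c • (f : C(spectrum ℝ T, ℝ)) := rfl
        rw [this, map_smul]
        simp [inner_smul_right_eq_smul] }
    (fun f hf => by
      have h : 0 ≤ cfcHom hT (f : C(spectrum ℝ T, ℝ)) :=
        (cfcHom_nonneg_iff hT).2 (fun t => hf t)
      exact ((ContinuousLinearMap.nonneg_iff_isPositive _).1 h).re_inner_nonneg_right x)

/-- The scalar spectral measure `μ_x` of `T` on `ℝ`, with `∫ f dμ_x = ⟪x, f(T) x⟫`. -/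
def scalarSpectralMeasure {T : H →L[ℂ] H} (hT : IsSelfAdjoint T) (x : H) : Measure ℝ :=
  (RealRMK.rieszMeasure (spectralFunctional hT x)).map Subtype.val

variable {T : H →L[ℂ] H} (hT : IsSelfAdjoint T)

instance isFiniteMeasure_scalarSpectralMeasure (x : H) :
    IsFiniteMeasure (scalarSpectralMeasure hT x) := by
  unfold scalarSpectralMeasure; infer_instance

theorem integral_scalarSpectralMeasure (x : H) {f : ℝ → ℝ} (hf : Continuous f) :
    ∫ t, f t ∂(scalarSpectralMeasure hT x) = (⟪x, cfc f T x⟫_ℂ).re := by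
  unfold scalarSpectralMeasure
  rw [integral_map measurable_subtype_coe.aemeasurable hf.aestronglyMeasurable]
  have := RealRMK.integral_rieszMeasure (spectralFunctional hT x)
    (CompactlySupportedContinuousMap.continuousMapEquiv ⟨_, hf.continuousOn.domRestrict⟩)
  rw [cfc_apply f T hT hf.continuousOn]
  exact this

theorem integrable_scalarSpectralMeasure (x : H) {f : ℝ → ℝ} (hf : Continuous f) :
    Integrable f (scalarSpectralMeasure hT x) := by
  unfold scalarSpectralMeasure
  rw [integrable_map_measure hf.aestronglyMeasurable measurable_subtype_coe.aemeasurable]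
  have hc : Continuous (f ∘ (Subtype.val : spectrum ℝ T → ℝ)) := hf.comp continuous_subtype_val
  exact hc.integrable_of_hasCompactSupport (HasCompactSupport.of_compactSpace _)

theorem scalarSpectralMeasure_univ (x : H) :
    (scalarSpectralMeasure hT x).real Set.univ = ‖x‖ ^ 2 := by
  have := integral_scalarSpectralMeasure hT x (f := fun _ => 1) continuous_const
  rw [cfc_const_one ℝ T] at this
  simpa [← @inner_self_eq_norm_sq ℂ] using this

/-- A linear relation between quadratic forms of self-adjoint operators passes to
`x ↦ μ_x(Δ)`. -/
theorem scalarSpectralMeasure_relation {ι : Type*} [Fintype ι] (c : ι → ℝ) (x : ι → H)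
    (h : ∀ A : H →L[ℂ] H, IsSelfAdjoint A → ∑ i, c i * (⟪x i, A (x i)⟫_ℂ).re = 0) (Δ : Set ℝ) :
    ∑ i, c i * (scalarSpectralMeasure hT (x i)).real Δ = 0 := by
  have key : ∑ i, (c i).toNNReal • scalarSpectralMeasure hT (x i) =
      ∑ i, (-c i).toNNReal • scalarSpectralMeasure hT (x i) := by
    refine ext_of_forall_integral_eq_of_IsFiniteMeasure fun f => ?_
    have hf := f.continuous
    rw [integral_finsetSum_measure, integral_finsetSum_measure]
    · simp only [integral_smul_nnreal_measure, integral_scalarSpectralMeasure hT _ hf]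
      rw [← sub_eq_zero, ← Finset.sum_sub_distrib, ← h (cfc f T) (cfc_predicate f T)]
      refine Finset.sum_congr rfl fun i _ => ?_
      simp only [NNReal.smul_def, Real.coe_toNNReal', smul_eq_mul]
      nth_rewrite 3 [← max_zero_sub_max_neg_zero_eq_self (c i)]
      ring
    · exact fun i _ => (integrable_scalarSpectralMeasure hT _ hf).smul_measure_nnreal
    · exact fun i _ => (integrable_scalarSpectralMeasure hT _ hf).smul_measure_nnreal
  have := congrArg (fun μ : Measure ℝ => μ.real Δ) key
  simp only [measureReal_def, Measure.coe_finsetSum, Finset.sum_apply, Measure.smul_apply] at this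
  rw [ENNReal.toReal_sum (by simp [ENNReal.smul_def, ENNReal.mul_eq_top]),
    ENNReal.toReal_sum (by simp [ENNReal.smul_def, ENNReal.mul_eq_top])] at this
  simp only [ENNReal.smul_def, smul_eq_mul, ENNReal.toReal_mul, ENNReal.coe_toReal,
    Real.coe_toNNReal'] at this
  rw [← sub_eq_zero, ← Finset.sum_sub_distrib] at this
  rw [← this]
  refine Finset.sum_congr rfl fun i _ => ?_
  nth_rewrite 1 [← max_zero_sub_max_neg_zero_eq_self (c i)]
  rw [measureReal_def]
  ring

/-- The polarised measure `(μ_{x+y}(Δ) - μ_{x-y}(Δ)) / 4`, the real part of `⟪x, E(Δ) y⟫`. -/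
def spectralPolar (Δ : Set ℝ) (x y : H) : ℝ :=
  ((scalarSpectralMeasure hT (x + y)).real Δ - (scalarSpectralMeasure hT (x - y)).real Δ) / 4

theorem re_inner_polar {A : H →L[ℂ] H} (hA : IsSelfAdjoint A) (x y : H) :
    (⟪x + y, A (x + y)⟫_ℂ).re - (⟪x - y, A (x - y)⟫_ℂ).re = 4 * (⟪x, A y⟫_ℂ).re := by
  have h : (⟪y, A x⟫_ℂ).re = (⟪x, A y⟫_ℂ).re := by
    have h1 : ⟪A y, x⟫_ℂ = ⟪y, A x⟫_ℂ := hA.isSymmetric y x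
    rw [← h1, ← inner_conj_symm, Complex.conj_re]
  simp only [map_add, map_sub, inner_add_left, inner_add_right, inner_sub_left, inner_sub_right,
    Complex.add_re, Complex.sub_re, h]
  ring

theorem spectralPolar_relation {ι : Type*} [Fintype ι] (c : ι → ℝ) (x y : ι → H)
    (h : ∀ A : H →L[ℂ] H, IsSelfAdjoint A → ∑ i, c i * (⟪x i, A (y i)⟫_ℂ).re = 0) (Δ : Set ℝ) :
    ∑ i, c i * spectralPolar hT Δ (x i) (y i) = 0 := by
  have := scalarSpectralMeasure_relation hT (ι := ι ⊕ ι) (Sum.elim c (-c))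
    (Sum.elim (fun i => x i + y i) (fun i => x i - y i)) (fun A hA => by
      simp only [Fintype.sum_sum_type, Sum.elim_inl, Sum.elim_inr, Pi.neg_apply]
      rw [← Finset.sum_add_distrib, ← mul_zero 4, ← h A hA, Finset.mul_sum]
      refine Finset.sum_congr rfl fun i _ => ?_
      linear_combination (c i) * re_inner_polar hA (x i) (y i)) Δ
  simp only [Fintype.sum_sum_type, Sum.elim_inl, Sum.elim_inr, Pi.neg_apply] at this
  rw [← Finset.sum_add_distrib] at this
  rw [← mul_zero (1 / 4 : ℝ), ← this, Finset.mul_sum]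
  refine Finset.sum_congr rfl fun i _ => ?_
  unfold spectralPolar
  ring

theorem spectralPolar_relation₃ (Δ : Set ℝ) (a b c : ℝ) (x₁ x₂ x₃ y₁ y₂ y₃ : H)
    (h : ∀ A : H →L[ℂ] H, IsSelfAdjoint A →
      a * (⟪x₁, A y₁⟫_ℂ).re = b * (⟪x₂, A y₂⟫_ℂ).re + c * (⟪x₃, A y₃⟫_ℂ).re) :
    a * spectralPolar hT Δ x₁ y₁ = b * spectralPolar hT Δ x₂ y₂ +
      c * spectralPolar hT Δ x₃ y₃ := by
  have := spectralPolar_relation hT ![a, -b, -c] ![x₁, x₂, x₃] ![y₁, y₂, y₃] (fun A hA => by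
    simp only [Fin.sum_univ_three, Matrix.cons_val]
    linear_combination h A hA) Δ
  simp only [Fin.sum_univ_three, Matrix.cons_val] at this
  linear_combination this

theorem scalarSpectralMeasure_real_le (Δ : Set ℝ) (x : H) :
    (scalarSpectralMeasure hT x).real Δ ≤ ‖x‖ ^ 2 :=
  (measureReal_mono (Set.subset_univ Δ)).trans_eq (scalarSpectralMeasure_univ hT x)

/-- The sesquilinear form `(x, y) ↦ ⟪x, E(Δ) y⟫`. -/
def spectralSesq (Δ : Set ℝ) : H →ₗ⋆[ℂ] H →ₗ[ℂ] ℂ :=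
  LinearMap.mk₂'ₛₗ (starRingEnd ℂ) (RingHom.id ℂ)
    (fun x y => ⟨spectralPolar hT Δ x y, spectralPolar hT Δ (Complex.I • x) y⟩)
    (fun x x' y => by
      apply Complex.ext
      · simpa using spectralPolar_relation₃ hT Δ 1 1 1 (x + x') x x' y y y
          (fun A _ => by simp)
      · simpa using spectralPolar_relation₃ hT Δ 1 1 1 (Complex.I • (x + x')) (Complex.I • x)
          (Complex.I • x') y y y (fun A _ => by simp))
    (fun c x y => by
      apply Complex.ext
      · simpa using spectralPolar_relation₃ hT Δ 1 c.re c.im (c • x) x (Complex.I • x) y y y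
          (fun A _ => by simp; ring)
      · simpa [add_comm, sub_eq_add_neg] using spectralPolar_relation₃ hT Δ 1 c.re (-c.im)
          (Complex.I • c • x) (Complex.I • x) x y y y
          (fun A _ => by simp; ring))
    (fun x y y' => by
      apply Complex.ext
      · simpa using spectralPolar_relation₃ hT Δ 1 1 1 x x x (y + y') y y'
          (fun A _ => by simp)
      · simpa using spectralPolar_relation₃ hT Δ 1 1 1 (Complex.I • x) (Complex.I • x)
          (Complex.I • x) (y + y') y y' (fun A _ => by simp))
    (fun c x y => by
      apply Complex.ext
      · simpa [sub_eq_add_neg] using spectralPolar_relation₃ hT Δ 1 c.re (-c.im) x x (Complex.I • x)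
          (c • y) y y (fun A _ => by simp; ring)
      · simpa using spectralPolar_relation₃ hT Δ 1 c.re c.im (Complex.I • x) (Complex.I • x) x
          (c • y) y y (fun A _ => by simp; ring))

theorem abs_spectralPolar_le (Δ : Set ℝ) (x y : H) :
    |spectralPolar hT Δ x y| ≤ (‖x‖ + ‖y‖) ^ 2 / 4 := by
  have h1 := scalarSpectralMeasure_real_le hT Δ (x + y)
  have h2 := scalarSpectralMeasure_real_le hT Δ (x - y)
  have h3 : ‖x + y‖ ^ 2 ≤ (‖x‖ + ‖y‖) ^ 2 := by gcongr; exact norm_add_le x y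
  have h4 : ‖x - y‖ ^ 2 ≤ (‖x‖ + ‖y‖) ^ 2 := by gcongr; exact norm_sub_le x y
  have h5 : 0 ≤ (scalarSpectralMeasure hT (x + y)).real Δ := measureReal_nonneg
  have h6 : 0 ≤ (scalarSpectralMeasure hT (x - y)).real Δ := measureReal_nonneg
  unfold spectralPolar
  rw [abs_le]
  constructor <;> linarith

theorem norm_spectralSesq_le (Δ : Set ℝ) (x y : H) :
    ‖spectralSesq hT Δ x y‖ ≤ 2 * ‖x‖ * ‖y‖ := by
  have unit : ∀ u v : H, ‖u‖ = 1 → ‖v‖ = 1 → ‖spectralSesq hT Δ u v‖ ≤ 2 := fun u v hu hv => by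
    have h1 := abs_spectralPolar_le hT Δ u v
    have h2 := abs_spectralPolar_le hT Δ (Complex.I • u) v
    rw [norm_smul, Complex.norm_I] at h2
    rw [hu, hv] at h1 h2
    refine (Complex.norm_le_abs_re_add_abs_im _).trans ?_
    change |spectralPolar hT Δ u v| + |spectralPolar hT Δ (Complex.I • u) v| ≤ 2
    linarith
  rcases eq_or_ne x 0 with rfl | hx
  · simp
  rcases eq_or_ne y 0 with rfl | hy
  · simp
  have hx' : ‖x‖ ≠ 0 := norm_ne_zero_iff.2 hx
  have hy' : ‖y‖ ≠ 0 := norm_ne_zero_iff.2 hy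
  have := unit (((‖x‖ : ℂ)⁻¹) • x) (((‖y‖ : ℂ)⁻¹) • y) (by simp [norm_smul, hx'])
    (by simp [norm_smul, hy'])
  simp only [map_smul, LinearMap.map_smulₛₗ, LinearMap.smul_apply, smul_eq_mul,
    norm_mul, map_inv₀, Complex.conj_ofReal, norm_inv, Complex.norm_real, norm_norm] at this
  have h := mul_le_mul_of_nonneg_left this (mul_nonneg (norm_nonneg x) (norm_nonneg y))
  calc _ = ‖x‖ * ‖y‖ * (‖y‖⁻¹ * (‖x‖⁻¹ * ‖spectralSesq hT Δ x y‖)) := by field_simp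
    _ ≤ ‖x‖ * ‖y‖ * 2 := by simpa [mul_comm, mul_left_comm] using h
    _ = _ := by ring

/-- The spectral projection `E(Δ)`: the operator of the form `(x, y) ↦ ⟪x, E(Δ) y⟫`. -/
def spectralProjection (Δ : Set ℝ) : H →L[ℂ] H :=
  InnerProductSpace.continuousLinearMapOfBilin
    ((spectralSesq hT Δ).mkContinuous₂ 2 (norm_spectralSesq_le hT Δ))

theorem inner_spectralProjection_left (Δ : Set ℝ) (x y : H) :
    (⟪spectralProjection hT Δ x, y⟫_ℂ).re = spectralPolar hT Δ x y := by
  unfold spectralProjection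
  rw [InnerProductSpace.continuousLinearMapOfBilin_apply]
  rfl

theorem inner_spectralProjection_self (Δ : Set ℝ) (x : H) :
    ⟪spectralProjection hT Δ x, x⟫_ℂ = (scalarSpectralMeasure hT x).real Δ := by
  apply Complex.ext
  · rw [inner_spectralProjection_left, spectralPolar]
    have := scalarSpectralMeasure_relation hT ![1, -1, -4] ![x + x, x - x, x] (fun A hA => by
      simp [Fin.sum_univ_three]; ring) Δ
    simp only [Fin.sum_univ_three, Matrix.cons_val] at this
    rw [Complex.ofReal_re]
    linear_combination this / 4
  · have h : (⟪spectralProjection hT Δ x, x⟫_ℂ).im = spectralPolar hT Δ (Complex.I • x) x := by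
      rw [← inner_spectralProjection_left]
      simp
    have := spectralPolar_relation₃ hT Δ 1 0 0 (Complex.I • x) x x x x x (fun A hA => by
      have := hA.isSymmetric.im_inner_self_apply x
      simpa using this)
    rw [h]
    simpa using this

theorem inner_self_eq_ofReal_norm_sq {H : Type*} [NormedAddCommGroup H]
    [InnerProductSpace ℂ H] (v : H) : ⟪v, v⟫_ℂ = ((‖v‖ ^ 2 : ℝ) : ℂ) := by
  rw [inner_self_eq_norm_sq_to_K]; push_cast; rfl

theorem isSelfAdjoint_spectralProjection (Δ : Set ℝ) :
    IsSelfAdjoint (spectralProjection hT Δ) := by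
  rw [ContinuousLinearMap.isSelfAdjoint_iff_isSymmetric,
    LinearMap.isSymmetric_iff_inner_map_self_real]
  intro x
  simp [inner_spectralProjection_self]

theorem re_inner_spectralProjection (Δ : Set ℝ) {u v : H} {ν₁ ν₂ : Measure ℝ}
    [IsFiniteMeasure ν₁] [IsFiniteMeasure ν₂]
    (h : ∀ f : ℝ →ᵇ ℝ, (⟪u, cfc f T v⟫_ℂ).re = ∫ t, f t ∂ν₁ - ∫ t, f t ∂ν₂) :
    (⟪spectralProjection hT Δ u, v⟫_ℂ).re = ν₁.real Δ - ν₂.real Δ := by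
  have key : scalarSpectralMeasure hT (u + v) + (4 : ℝ≥0) • ν₂ =
      scalarSpectralMeasure hT (u - v) + (4 : ℝ≥0) • ν₁ := by
    refine ext_of_forall_integral_eq_of_IsFiniteMeasure fun f => ?_
    have hf := f.continuous
    rw [integral_add_measure (integrable_scalarSpectralMeasure hT _ hf) (f.integrable _),
      integral_add_measure (integrable_scalarSpectralMeasure hT _ hf) (f.integrable _)]
    simp only [integral_smul_nnreal_measure, integral_scalarSpectralMeasure hT _ hf,
      NNReal.smul_def, smul_eq_mul, NNReal.coe_ofNat]
    linear_combination re_inner_polar (A := cfc f T) (cfc_predicate f T) u v + 4 * h f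
  have := congrArg (fun μ : Measure ℝ => μ.real Δ) key
  rw [measureReal_add_apply, measureReal_add_apply, measureReal_nnreal_smul_apply,
    measureReal_nnreal_smul_apply, NNReal.coe_ofNat] at this
  rw [inner_spectralProjection_left, spectralPolar]
  linear_combination this / 4

theorem re_inner_spectralProjection_cfc {Δ : Set ℝ} (hΔ : MeasurableSet Δ) (x : H)
    (g : ℝ →ᵇ ℝ) :
    (⟪spectralProjection hT Δ x, cfc g T x⟫_ℂ).re =
      ∫ t in Δ, g t ∂(scalarSpectralMeasure hT x) := by
  have hg := g.continuous
  have hm : ∀ f : ℝ → ℝ, Continuous f → Measurable fun t => ENNReal.ofReal (f t) :=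
    fun f hf => hf.measurable.ennreal_ofReal
  have fin : ∀ f : ℝ → ℝ, Continuous f → IsFiniteMeasure
      ((scalarSpectralMeasure hT x).withDensity fun t => ENNReal.ofReal (f t)) := fun f hf =>
    isFiniteMeasure_withDensity_ofReal (integrable_scalarSpectralMeasure hT x hf).2
  have := fin g hg
  have := fin (fun t => - g t) hg.neg
  rw [re_inner_spectralProjection hT Δ
    (ν₁ := (scalarSpectralMeasure hT x).withDensity fun t => ENNReal.ofReal (g t))
    (ν₂ := (scalarSpectralMeasure hT x).withDensity fun t => ENNReal.ofReal (- g t)),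
    integral_eq_lintegral_pos_part_sub_lintegral_neg_part
      (integrable_scalarSpectralMeasure hT x hg).integrableOn,
    measureReal_def, measureReal_def, withDensity_apply _ hΔ, withDensity_apply _ hΔ]
  intro f
  have hf := f.continuous
  have h1 : cfc f T (cfc g T x) = cfc (fun t => f t * g t) T x := by
    rw [cfc_mul f g T hf.continuousOn hg.continuousOn]; rfl
  rw [h1, ← integral_scalarSpectralMeasure hT x (f := fun t => f t * g t) (by fun_prop),
    integral_withDensity_eq_integral_toReal_smul (hm _ hg) (by simp),
    integral_withDensity_eq_integral_toReal_smul (hm (fun t => - g t) hg.neg) (by simp), ← integral_sub]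
  · refine integral_congr_ae (.of_forall fun t => ?_)
    simp only [ENNReal.toReal_ofReal', smul_eq_mul]
    nth_rewrite 1 [← max_zero_sub_max_neg_zero_eq_self (g t)]
    ring
  · simp only [ENNReal.toReal_ofReal', smul_eq_mul]
    exact integrable_scalarSpectralMeasure hT x (by fun_prop)
  · simp only [ENNReal.toReal_ofReal', smul_eq_mul]
    exact integrable_scalarSpectralMeasure hT x (by fun_prop)

theorem isStarProjection_spectralProjection {Δ : Set ℝ} (hΔ : MeasurableSet Δ) :
    IsStarProjection (spectralProjection hT Δ) := by
  have hsa := isSelfAdjoint_spectralProjection hT Δ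
  refine ⟨?_, hsa⟩
  refine (ContinuousLinearMap.coe_inj).1 ((ext_inner_map _ _).1 fun x => ?_)
  have h := re_inner_spectralProjection hT Δ (u := spectralProjection hT Δ x) (v := x)
    (ν₁ := (scalarSpectralMeasure hT x).restrict Δ) (ν₂ := 0) (fun f => by
      rw [re_inner_spectralProjection_cfc hT hΔ]; simp)
  have h2 : ⟪spectralProjection hT Δ (spectralProjection hT Δ x), x⟫_ℂ =
      ⟪spectralProjection hT Δ x, spectralProjection hT Δ x⟫_ℂ := hsa.isSymmetric _ _
  change ⟪spectralProjection hT Δ (spectralProjection hT Δ x), x⟫_ℂ =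
    ⟪spectralProjection hT Δ x, x⟫_ℂ
  rw [h2, inner_self_eq_ofReal_norm_sq, Complex.ofReal_re, measureReal_restrict_apply hΔ, Set.inter_self, measureReal_zero_apply,
    sub_zero] at h
  rw [inner_spectralProjection_self, h2, inner_self_eq_ofReal_norm_sq, h]

theorem norm_spectralProjection_sq {Δ : Set ℝ} (hΔ : MeasurableSet Δ) (x : H) :
    ‖spectralProjection hT Δ x‖ ^ 2 = (scalarSpectralMeasure hT x).real Δ := by
  have hP := isStarProjection_spectralProjection hT hΔ
  have h1 : spectralProjection hT Δ (spectralProjection hT Δ x) = spectralProjection hT Δ x :=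
    congrArg (fun A : H →L[ℂ] H => A x) hP.isIdempotentElem.eq
  have h2 : ⟪spectralProjection hT Δ (spectralProjection hT Δ x), x⟫_ℂ =
      ⟪spectralProjection hT Δ x, spectralProjection hT Δ x⟫_ℂ :=
    hP.isSelfAdjoint.isSymmetric _ _
  rw [h1, inner_spectralProjection_self, inner_self_eq_ofReal_norm_sq] at h2
  exact_mod_cast h2.symm

theorem spectralProjection_ext {A : H →L[ℂ] H} {Δ : Set ℝ}
    (h : ∀ x, ⟪A x, x⟫_ℂ = (scalarSpectralMeasure hT x).real Δ) :
    spectralProjection hT Δ = A :=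
  (ContinuousLinearMap.coe_inj).1 ((ext_inner_map _ _).1 fun x =>
    (inner_spectralProjection_self hT Δ x).trans (h x).symm)

theorem spectralProjection_univ : spectralProjection hT Set.univ = 1 :=
  spectralProjection_ext hT fun x => by
    rw [scalarSpectralMeasure_univ, one_apply_eq_self, inner_self_eq_ofReal_norm_sq]

theorem hasSum_spectralProjection (A : ℕ → Set ℝ) (hA : ∀ i, MeasurableSet (A i))
    (hd : Pairwise fun i j => Disjoint (A i) (A j)) (x : H) :
    HasSum (fun i => spectralProjection hT (A i) x) (spectralProjection hT (⋃ i, A i) x) := by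
  have hU : MeasurableSet (⋃ i, A i) := .iUnion hA
  have fin : ∀ s : Finset ℕ, spectralProjection hT (⋃ i, A i) - ∑ i ∈ s, spectralProjection hT (A i)
      = spectralProjection hT ((⋃ i, A i) \ ⋃ i ∈ s, A i) := fun s => by
    refine (spectralProjection_ext hT fun y => ?_).symm
    have hs : MeasurableSet (⋃ i ∈ s, A i) := Finset.measurableSet_biUnion s fun i _ => hA i
    rw [measureReal_sdiff (Set.iUnion₂_subset fun i _ => Set.subset_iUnion A i) hs,
      measureReal_biUnion_finset (fun i _ j _ hij => hd hij) (fun i _ => hA i)]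
    simp [inner_spectralProjection_self]
  have hm : HasSum (fun i => (scalarSpectralMeasure hT x).real (A i))
      ((scalarSpectralMeasure hT x).real (⋃ i, A i)) := by
    have := measure_iUnion (μ := scalarSpectralMeasure hT x) (fun i j hij => hd hij) hA
    rw [measureReal_def, this, ENNReal.tsum_toReal_eq fun i => measure_ne_top _ _]
    exact (ENNReal.summable_toReal (by rw [← this]; exact measure_ne_top _ _)).hasSum
  have norm : ∀ s : Finset ℕ,
      ‖∑ i ∈ s, spectralProjection hT (A i) x - spectralProjection hT (⋃ i, A i) x‖ ^ 2 =
        (scalarSpectralMeasure hT x).real (⋃ i, A i) -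
          ∑ i ∈ s, (scalarSpectralMeasure hT x).real (A i) := fun s => by
    have hs : MeasurableSet (⋃ i ∈ s, A i) := Finset.measurableSet_biUnion s fun i _ => hA i
    rw [norm_sub_rev, ← measureReal_biUnion_finset (fun i _ j _ hij => hd hij) (fun i _ => hA i),
      ← measureReal_sdiff (Set.iUnion₂_subset fun i _ => Set.subset_iUnion A i) hs,
      ← norm_spectralProjection_sq hT (hU.diff hs), ← fin s]
    simp
  rw [HasSum, tendsto_iff_norm_sub_tendsto_zero]
  have h0 := (tendsto_const_nhds (x := (scalarSpectralMeasure hT x).real (⋃ i, A i))).sub hm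
  rw [sub_self] at h0
  have h1 := h0.sqrt
  rw [Real.sqrt_zero] at h1
  refine h1.congr fun s => ?_
  rw [← norm s, Real.sqrt_sq (norm_nonneg _)]

/-- The projection-valued spectral measure `E_T` of a bounded self-adjoint operator `T`. -/
def spectralMeasure {T : H →L[ℂ] H} (hT : IsSelfAdjoint T) : ProjectionValuedMeasure H where
  toFun := spectralProjection hT
  isStarProjection _ hΔ := isStarProjection_spectralProjection hT hΔ
  univ := spectralProjection_univ hT
  hasSum := hasSum_spectralProjection hT

/-- `spectralMeasure` is the spectral measure: `T = ∫ t dE_T(t)`, in the weak sense, where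
`⟪E_T(·) x, x⟫` is the finite measure `scalarSpectralMeasure hT x`. -/
theorem spectralMeasure_spec (x : H) :
    (∀ Δ : Set ℝ, ⟪(spectralMeasure hT).toFun Δ x, x⟫_ℂ = (scalarSpectralMeasure hT x).real Δ) ∧
      Integrable (fun t => t) (scalarSpectralMeasure hT x) ∧
      ⟪T x, x⟫_ℂ = ((∫ t, t ∂(scalarSpectralMeasure hT x) : ℝ) : ℂ) := by
  refine ⟨fun Δ => inner_spectralProjection_self hT Δ x,
    integrable_scalarSpectralMeasure hT x continuous_id, ?_⟩
  rw [integral_scalarSpectralMeasure hT x (f := fun t => t) continuous_id, cfc_id' ℝ T]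
  have := hT.isSymmetric.coe_re_inner_self_apply x
  have h2 : ⟪T x, x⟫_ℂ = ⟪x, T x⟫_ℂ := hT.isSymmetric x x
  rw [h2]
  exact this.symm

end SpectralMeasure

section BlockOperator

variable {H₀ H₁ : Type*} [NormedAddCommGroup H₀] [InnerProductSpace ℂ H₀] [CompleteSpace H₀]
  [NormedAddCommGroup H₁] [InnerProductSpace ℂ H₁] [CompleteSpace H₁]

/-- The operator with block matrix `(A₀, V; V*, A₁)` on the orthogonal sum `H₀ ⊕ H₁`. -/
def blockOperator (A₀ : H₀ →L[ℂ] H₀) (A₁ : H₁ →L[ℂ] H₁) (V : H₁ →L[ℂ] H₀) :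
    WithLp 2 (H₀ × H₁) →L[ℂ] WithLp 2 (H₀ × H₁) :=
  (WithLp.prodContinuousLinearEquiv 2 ℂ H₀ H₁).symm ∘L
    ((A₀ ∘L WithLp.fstL 2 ℂ H₀ H₁ + V ∘L WithLp.sndL 2 ℂ H₀ H₁).prod
      (V.adjoint ∘L WithLp.fstL 2 ℂ H₀ H₁ + A₁ ∘L WithLp.sndL 2 ℂ H₀ H₁))

theorem isSelfAdjoint_blockOperator {A₀ : H₀ →L[ℂ] H₀} {A₁ : H₁ →L[ℂ] H₁} (hA₀ : IsSelfAdjoint A₀)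
    (hA₁ : IsSelfAdjoint A₁) (V : H₁ →L[ℂ] H₀) : IsSelfAdjoint (blockOperator A₀ A₁ V) := by
  rw [ContinuousLinearMap.isSelfAdjoint_iff_isSymmetric]
  intro x y
  have h0 : ⟪A₀ x.fst, y.fst⟫_ℂ = ⟪x.fst, A₀ y.fst⟫_ℂ := hA₀.isSymmetric _ _
  have h1 : ⟪A₁ x.snd, y.snd⟫_ℂ = ⟪x.snd, A₁ y.snd⟫_ℂ := hA₁.isSymmetric _ _
  change ⟪A₀ x.fst + V x.snd, y.fst⟫_ℂ + ⟪V.adjoint x.fst + A₁ x.snd, y.snd⟫_ℂ =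
    ⟪x.fst, A₀ y.fst + V y.snd⟫_ℂ + ⟪x.snd, V.adjoint y.fst + A₁ y.snd⟫_ℂ
  rw [inner_add_left, inner_add_left, inner_add_right, inner_add_right, h0, h1,
    ContinuousLinearMap.adjoint_inner_left, ContinuousLinearMap.adjoint_inner_right]
  ring

/-- For `Im z > 0` the operator `B - z` is invertible, so `Ring.inverse (B - z • 1)` below is its
inverse. -/
theorem isUnit_sub_smul_one {H : Type*} [NormedAddCommGroup H] [InnerProductSpace ℂ H]
    [CompleteSpace H] {B : H →L[ℂ] H} (hB : IsSelfAdjoint B) {z : ℂ} (hz : 0 < z.im) :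
    IsUnit (B - z • (1 : H →L[ℂ] H)) := by
  by_contra h
  have hmem : z ∈ spectrum ℂ B := by
    rw [spectrum.mem_iff, IsUnit.sub_iff, Algebra.algebraMap_eq_smul_one]
    exact h
  have := congrArg Complex.im (hB.mem_spectrum_eq_re hmem)
  rw [Complex.ofReal_im] at this
  exact hz.ne' this

/-- The inclusion `J : H₁ → H₀ ⊕ H₁`. -/
def inclusionSnd (H₀ H₁ : Type*) [NormedAddCommGroup H₀] [InnerProductSpace ℂ H₀]
    [NormedAddCommGroup H₁] [InnerProductSpace ℂ H₁] : H₁ →L[ℂ] WithLp 2 (H₀ × H₁) :=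
  (WithLp.prodContinuousLinearEquiv 2 ℂ H₀ H₁).symm ∘L ContinuousLinearMap.inr ℂ H₀ H₁

/-- The operator `M(z) = J* (B - z)⁻¹ J` on `H₁`. -/
def compressedResolvent (B : WithLp 2 (H₀ × H₁) →L[ℂ] WithLp 2 (H₀ × H₁)) (z : ℂ) :
    H₁ →L[ℂ] H₁ :=
  (inclusionSnd H₀ H₁).adjoint ∘L Ring.inverse (B - z • 1) ∘L inclusionSnd H₀ H₁

/-- The function `m(z) = tr (J* (B - z)⁻¹ J)`. -/
def traceResolvent (B : WithLp 2 (H₀ × H₁) →L[ℂ] WithLp 2 (H₀ × H₁)) (z : ℂ) : ℂ :=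
  LinearMap.trace ℂ H₁ (compressedResolvent B z : H₁ →ₗ[ℂ] H₁)

end BlockOperator

/-- `U` is a cyclic generating subspace for `T`. -/
def IsCyclicGenerating {H : Type*} [NormedAddCommGroup H] [InnerProductSpace ℂ H]
    (T : H →L[ℂ] H) (U : Submodule ℂ H) : Prop :=
  Dense (Submodule.span ℂ {x : H | ∃ k : ℕ, ∃ u ∈ U, x = (T ^ k) u} : Set H)

/-- Scalar Herglotz functions: holomorphic on the open upper half-plane with non-negative
imaginary part there. Values elsewhere are irrelevant. -/
def IsScalarHerglotz (m : ℂ → ℂ) : Prop :=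
  DifferentiableOn ℂ m {z | 0 < z.im} ∧ ∀ z : ℂ, 0 < z.im → 0 ≤ (m z).im

end

/-! Write `μ_x` for the measure `⟪x, E_B(·) x⟫`, choose an orthonormal basis `b i` of `H₁`, and take
for `ω` the sum of the `μ_{J b i}`, so that `ω(Δ) = tr (J* E_B(Δ) J)`. The functional calculus gives
`⟪x, (B - z)⁻¹ x⟫ = ∫ (t - z)⁻¹ dμ_x` (`inner_inverse_sub_smul_one`), and summing over the basis
gives the formula for `m` (`traceResolvent_eq_sum`). The support lies in the compact spectrum of
`B`. The Herglotz property is checked term by term: inversion is holomorphic on units, and `Im (t -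
z)⁻¹ ≥ 0` for real `t`.

The null sets are where cyclicity enters. Since `μ_x(Δ) = ‖E_B(Δ) x‖²`, `ω(Δ) = 0` says exactly that
`E_B(Δ)` annihilates `J H₁`. The kernel of `E_B(Δ)` is closed and invariant under `B`
(`spectralProjection_apply_apply_eq_zero`). A closed invariant subspace containing `J H₁` contains
`(V y, A₁ y)`, hence `(V y, 0)`, and repeating the argument, every `(A₀ ^ k V y, 0)`; these span a
dense subspace of `H₀`, so the subspace is everything (`eq_top_of_blockOperator_invariant`) and
`E_B(Δ) = 0`. -/

section SpectralMeasureLemmas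

variable {H : Type*} [NormedAddCommGroup H] [InnerProductSpace ℂ H] [CompleteSpace H]
  {T : H →L[ℂ] H} (hT : IsSelfAdjoint T)

/-! ### Support and quadratic forms of the scalar spectral measures. -/

theorem scalarSpectralMeasure_compl_spectrum (x : H) :
    scalarSpectralMeasure hT x (spectrum ℝ T)ᶜ = 0 := by
  have hc : IsCompact (spectrum ℝ T) := isCompact_iff_compactSpace.2 inferInstance
  unfold scalarSpectralMeasure
  rw [Measure.map_apply measurable_subtype_coe hc.measurableSet.compl]
  simp

/-- For real `f` the operator `cfc f T` is self-adjoint, so its quadratic form is real and nothing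
is lost in the real part of `integral_scalarSpectralMeasure`. -/
theorem inner_cfc_self (x : H) {f : ℝ → ℝ} (hf : Continuous f) :
    ⟪x, cfc f T x⟫_ℂ = ((∫ t, f t ∂(scalarSpectralMeasure hT x) : ℝ) : ℂ) := by
  rw [integral_scalarSpectralMeasure hT x hf]
  have hs : IsSelfAdjoint (cfc f T) := cfc_predicate f T
  have h : ⟪cfc f T x, x⟫_ℂ = ⟪x, cfc f T x⟫_ℂ := hs.isSymmetric x x
  rw [← h]
  exact (hs.isSymmetric.coe_re_inner_apply_self x).symm

/-! ### The Cauchy kernel and the resolvent. -/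

/-- The real part of `(t - z)⁻¹`. -/
noncomputable def cauchyKernelRe (z : ℂ) (t : ℝ) : ℝ := (t - z.re) / ((t - z.re) ^ 2 + z.im ^ 2)

/-- The imaginary part of `(t - z)⁻¹`. -/
noncomputable def cauchyKernelIm (z : ℂ) (t : ℝ) : ℝ := z.im / ((t - z.re) ^ 2 + z.im ^ 2)

variable {z : ℂ}

theorem cauchyKernel_denom_pos (hz : 0 < z.im) (t : ℝ) : 0 < (t - z.re) ^ 2 + z.im ^ 2 := by
  positivity

theorem continuous_cauchyKernelRe (hz : 0 < z.im) : Continuous (cauchyKernelRe z) := by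
  unfold cauchyKernelRe
  exact Continuous.div (by fun_prop) (by fun_prop) fun t => (cauchyKernel_denom_pos hz t).ne'

theorem continuous_cauchyKernelIm (hz : 0 < z.im) : Continuous (cauchyKernelIm z) := by
  unfold cauchyKernelIm
  exact Continuous.div (by fun_prop) (by fun_prop) fun t => (cauchyKernel_denom_pos hz t).ne'

theorem cauchyKernelIm_nonneg (hz : 0 < z.im) (t : ℝ) : 0 ≤ cauchyKernelIm z t :=
  div_nonneg hz.le (cauchyKernel_denom_pos hz t).le

theorem one_div_sub_eq_cauchyKernel (t : ℝ) :
    1 / ((t : ℂ) - z) = cauchyKernelRe z t + cauchyKernelIm z t * Complex.I := by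
  have h : Complex.normSq ((t : ℂ) - z) = (t - z.re) ^ 2 + z.im ^ 2 := by
    simp [Complex.normSq_apply]; ring
  apply Complex.ext
  · rw [one_div, Complex.inv_re, h]
    simp [-Complex.ofReal_div, cauchyKernelRe, Complex.ofReal_re]
  · rw [one_div, Complex.inv_im, h]
    simp [-Complex.ofReal_div, cauchyKernelIm, Complex.ofReal_re]

/-- The functional calculus here is over `ℝ`, so the complex kernel `(t - z)⁻¹` is fed to it as a
real and an imaginary part. -/
theorem inverse_sub_smul_one_eq_cfc (hT : IsSelfAdjoint T) (hz : 0 < z.im) :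
    Ring.inverse (T - z • (1 : H →L[ℂ] H)) =
      cfc (cauchyKernelRe z) T + Complex.I • cfc (cauchyKernelIm z) T := by
  have hf := continuous_cauchyKernelRe hz
  have hg := continuous_cauchyKernelIm hz
  have hmul : ∀ f : ℝ → ℝ, Continuous f → T * cfc f T = cfc (fun t => t * f t) T := fun f hf => by
    rw [cfc_mul (fun t => t) f T continuousOn_id hf.continuousOn, cfc_id' ℝ T]
  have hconst : ∀ (c : ℝ) (f : ℝ → ℝ), Continuous f → (c : ℂ) • cfc f T = cfc (fun t => c * f t) T :=
    fun c f hf => by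
      rw [cfc_const_mul c f T hf.continuousOn, Complex.coe_smul]
  -- `h1` and `h2` are the real and imaginary parts of the scalar identity `(t - z) * (t - z)⁻¹ =
  -- 1`, carried over to `T`.
  have h1 : T * cfc (cauchyKernelRe z) T - (z.re : ℂ) • cfc (cauchyKernelRe z) T +
      (z.im : ℂ) • cfc (cauchyKernelIm z) T = 1 := by
    rw [hmul _ hf, hconst _ _ hf, hconst _ _ hg, ← cfc_sub .., ← cfc_add .., ← cfc_const_one ℝ T]
    · refine cfc_congr fun t _ => ?_
      have := (cauchyKernel_denom_pos hz t).ne'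
      simp only [cauchyKernelRe, cauchyKernelIm]
      field_simp
  have h2 : T * cfc (cauchyKernelIm z) T - (z.re : ℂ) • cfc (cauchyKernelIm z) T -
      (z.im : ℂ) • cfc (cauchyKernelRe z) T = 0 := by
    rw [hmul _ hg, hconst _ _ hf, hconst _ _ hg, ← cfc_sub .., ← cfc_sub .., ← cfc_const_zero ℝ T]
    · refine cfc_congr fun t _ => ?_
      have := (cauchyKernel_denom_pos hz t).ne'
      simp only [cauchyKernelRe, cauchyKernelIm]
      field_simp
      ring
  have h3 : (T - z • (1 : H →L[ℂ] H)) *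
      (cfc (cauchyKernelRe z) T + Complex.I • cfc (cauchyKernelIm z) T) = 1 := by
    have hzz : z • (1 : H →L[ℂ] H) = (z.re : ℂ) • 1 + ((z.im : ℂ) * Complex.I) • 1 := by
      rw [← add_smul, Complex.re_add_im]
    have hI : Complex.I * Complex.I = -1 := Complex.I_mul_I
    rw [hzz]
    calc _ = (T * cfc (cauchyKernelRe z) T - (z.re : ℂ) • cfc (cauchyKernelRe z) T +
          (z.im : ℂ) • cfc (cauchyKernelIm z) T) + Complex.I • (T * cfc (cauchyKernelIm z) T -
          (z.re : ℂ) • cfc (cauchyKernelIm z) T - (z.im : ℂ) • cfc (cauchyKernelRe z) T) := by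
            simp only [sub_mul, add_mul, mul_add, smul_mul_assoc, one_mul, mul_smul_comm]
            match_scalars
            all_goals first | ring1 | linear_combination (-(z.im : ℂ)) * hI
      _ = 1 := by rw [h1, h2, smul_zero, add_zero]
  -- As `T - z` is already known to be a unit, the right inverse found in `h3` is its inverse.
  have hu := isUnit_sub_smul_one hT hz
  exact (Ring.inverse_mul_eq_iff_eq_mul _ _ _ hu).2 h3.symm |> (mul_one _).symm.trans

theorem integrable_one_div_sub_scalarSpectralMeasure (hz : 0 < z.im) (x : H) :
    Integrable (fun t : ℝ => 1 / ((t : ℂ) - z)) (scalarSpectralMeasure hT x) := by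
  simp only [one_div_sub_eq_cauchyKernel]
  exact (integrable_scalarSpectralMeasure hT x (continuous_cauchyKernelRe hz)).ofReal.add
    ((integrable_scalarSpectralMeasure hT x (continuous_cauchyKernelIm hz)).ofReal.mul_const _)

theorem inner_inverse_sub_smul_one (hz : 0 < z.im) (x : H) :
    ⟪x, Ring.inverse (T - z • (1 : H →L[ℂ] H)) x⟫_ℂ =
      ∫ t : ℝ, 1 / ((t : ℂ) - z) ∂(scalarSpectralMeasure hT x) := by
  simp only [one_div_sub_eq_cauchyKernel]
  rw [integral_add
      (integrable_scalarSpectralMeasure hT x (continuous_cauchyKernelRe hz)).ofReal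
      ((integrable_scalarSpectralMeasure hT x (continuous_cauchyKernelIm hz)).ofReal.mul_const _),
    integral_mul_const, integral_complex_ofReal, integral_complex_ofReal,
    inverse_sub_smul_one_eq_cfc hT hz, ← inner_cfc_self hT x (continuous_cauchyKernelRe hz),
    ← inner_cfc_self hT x (continuous_cauchyKernelIm hz)]
  rw [add_apply, smul_apply, inner_add_right, inner_smul_right, mul_comm Complex.I]

theorem differentiableAt_inner_inverse_sub_smul_one (hT : IsSelfAdjoint T) (hz : 0 < z.im)
    (x y : H) :
    DifferentiableAt ℂ (fun z : ℂ => ⟪x, Ring.inverse (T - z • (1 : H →L[ℂ] H)) y⟫_ℂ) z := by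
  have hsub : DifferentiableAt ℂ (fun z : ℂ => T - z • (1 : H →L[ℂ] H)) z := by fun_prop
  have hR : DifferentiableAt ℂ (fun z : ℂ => Ring.inverse (T - z • (1 : H →L[ℂ] H))) z :=
    DifferentiableAt.fun_comp' z
      (differentiableAt_inverse (𝕜 := ℂ) (R := H →L[ℂ] H) (isUnit_sub_smul_one hT hz)) hsub
  exact (innerSL ℂ x).differentiableAt.comp z (hR.clm_apply (differentiableAt_const y))

/-- The imaginary part is the integral of the nonnegative function `cauchyKernelIm z` against `μ_x`.
-/
theorem im_inner_inverse_sub_smul_one_nonneg (hT : IsSelfAdjoint T) (hz : 0 < z.im) (x : H) :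
    0 ≤ (⟪x, Ring.inverse (T - z • (1 : H →L[ℂ] H)) x⟫_ℂ).im := by
  rw [inverse_sub_smul_one_eq_cfc hT hz]
  simp only [add_apply, smul_apply, inner_add_right,
    inner_smul_right, inner_cfc_self hT x (continuous_cauchyKernelRe hz),
    inner_cfc_self hT x (continuous_cauchyKernelIm hz)]
  simpa using integral_nonneg fun t => cauchyKernelIm_nonneg hz t

/-- Because `⟪T x, f(T) T x⟫ = ⟪x, T f(T) T x⟫`, integrating `f` against `μ_{T x}` is integrating
`t² f(t)` against `μ_x`. The use of this is that `μ_{T x}` is absolutely continuous with respect to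
`μ_x`. -/
theorem scalarSpectralMeasure_apply_eq_withDensity (x : H) :
    scalarSpectralMeasure hT (T x) =
      (scalarSpectralMeasure hT x).withDensity fun t => ENNReal.ofReal (t ^ 2) := by
  have : IsFiniteMeasure
      ((scalarSpectralMeasure hT x).withDensity fun t => ENNReal.ofReal (t ^ 2)) :=
    isFiniteMeasure_withDensity_ofReal
      (integrable_scalarSpectralMeasure hT x (f := fun t => t ^ 2) (by fun_prop)).2
  refine ext_of_forall_integral_eq_of_IsFiniteMeasure fun f => ?_
  have hf := f.continuous
  rw [integral_withDensity_eq_integral_toReal_smul (by fun_prop) (by simp),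
    integral_scalarSpectralMeasure hT _ hf]
  -- One factor `t` is placed on each side of `f`, so that the left copy of `T` can be moved across
  -- the inner product by symmetry.
  have h1 : ∀ t : ℝ, (ENNReal.ofReal (t ^ 2)).toReal • f t = t * (f t * t) := fun t => by
    rw [ENNReal.toReal_ofReal (sq_nonneg t), smul_eq_mul]; ring
  simp only [h1]
  rw [integral_scalarSpectralMeasure hT x (f := fun t => t * (f t * t)) (by fun_prop),
    cfc_mul (fun t => t) (fun t => f t * t) T continuousOn_id
      (hf.mul continuous_id).continuousOn,
    cfc_mul f (fun t => t) T hf.continuousOn continuousOn_id, cfc_id' ℝ T]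
  congr 1
  exact hT.isSymmetric x (cfc f T (T x))

theorem spectralProjection_apply_eq_zero_iff {Δ : Set ℝ} (hΔ : MeasurableSet Δ) (x : H) :
    spectralProjection hT Δ x = 0 ↔ scalarSpectralMeasure hT x Δ = 0 := by
  rw [← norm_eq_zero, ← sq_eq_zero_iff, norm_spectralProjection_sq hT hΔ, measureReal_eq_zero_iff]

/-- Invariance of `ker E(Δ)` under `T` follows from absolute continuity of `μ_{T x}`, with no need
for `T` and `E(Δ)` to be shown to commute. -/
theorem spectralProjection_apply_apply_eq_zero {Δ : Set ℝ} (hΔ : MeasurableSet Δ) {x : H}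
    (hx : spectralProjection hT Δ x = 0) : spectralProjection hT Δ (T x) = 0 := by
  rw [spectralProjection_apply_eq_zero_iff hT hΔ] at hx ⊢
  rw [scalarSpectralMeasure_apply_eq_withDensity]
  exact withDensity_absolutelyContinuous _ _ hx

end SpectralMeasureLemmas

/-! ### Cyclicity of `H₁` for the block operator, and the trace of the compressed resolvent. -/

section BlockOperatorLemmas

variable {H₀ H₁ : Type*} [NormedAddCommGroup H₀] [InnerProductSpace ℂ H₀]
  [NormedAddCommGroup H₁] [InnerProductSpace ℂ H₁]

/-- If `Ran V` is cyclic generating for `A₀`, then a closed subspace containing `H₁` and invariant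
under the block operator is everything. -/
theorem eq_top_of_blockOperator_invariant [CompleteSpace H₀] [CompleteSpace H₁]
    {A₀ : H₀ →L[ℂ] H₀} {A₁ : H₁ →L[ℂ] H₁} {V : H₁ →L[ℂ] H₀}
    (hV : IsCyclicGenerating A₀ (LinearMap.range (V : H₁ →ₗ[ℂ] H₀)))
    {N : Submodule ℂ (WithLp 2 (H₀ × H₁))}
    (hN : IsClosed (N : Set (WithLp 2 (H₀ × H₁)))) (hJ : ∀ y, inclusionSnd H₀ H₁ y ∈ N)
    (hB : ∀ x ∈ N, blockOperator A₀ A₁ V x ∈ N) : N = ⊤ := by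
  let I : H₀ →L[ℂ] WithLp 2 (H₀ × H₁) :=
    (WithLp.prodContinuousLinearEquiv 2 ℂ H₀ H₁).symm ∘L ContinuousLinearMap.inl ℂ H₀ H₁
  have hsplit : ∀ w : WithLp 2 (H₀ × H₁), I w.fst + inclusionSnd H₀ H₁ w.snd = w := fun w => by
    apply WithLp.ofLp_injective
    exact Prod.ext (add_zero _) (zero_add _)
  -- Since `N` contains all of `H₁`, the second component of a vector in `N` can be subtracted off
  -- without leaving `N`.
  have hI : ∀ w ∈ N, I w.fst ∈ N := fun w hw => by
    rw [eq_sub_of_add_eq (hsplit w)]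
    exact N.sub_mem hw (hJ _)
  have hbase : ∀ y, I (V y) ∈ N := fun y => by
    have h := hI _ (hB _ (hJ y))
    have e : (blockOperator A₀ A₁ V (inclusionSnd H₀ H₁ y)).fst = V y := by
      change A₀ 0 + V y = V y
      simp
    rwa [e] at h
  have hstep : ∀ x, I x ∈ N → I (A₀ x) ∈ N := fun x hx => by
    have h := hI _ (hB _ hx)
    have e : (blockOperator A₀ A₁ V (I x)).fst = A₀ x := by
      change A₀ x + V 0 = A₀ x
      simp
    rwa [e] at h
  have hpow : ∀ (k : ℕ) (y : H₁), I ((A₀ ^ k) (V y)) ∈ N := fun k y => by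
    induction k with
    | zero => exact hbase y
    | succ k ih => rw [pow_succ']; exact hstep _ ih
  have hspan : Submodule.span ℂ {x : H₀ | ∃ k : ℕ, ∃ u ∈ LinearMap.range (V : H₁ →ₗ[ℂ] H₀),
      x = (A₀ ^ k) u} ≤ N.comap (I : H₀ →ₗ[ℂ] WithLp 2 (H₀ × H₁)) := by
    rw [Submodule.span_le]
    rintro _ ⟨k, _, ⟨y, rfl⟩, rfl⟩
    exact hpow k y
  have hall : ∀ x, I x ∈ N := fun x => by
    have hcl : IsClosed {x | I x ∈ N} := hN.preimage I.continuous
    exact hcl.closure_subset_iff.2 hspan (hV x)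
  rw [eq_top_iff]
  intro w _
  rw [← hsplit w]
  exact N.add_mem (hall _) (hJ _)

variable [CompleteSpace H₀] [CompleteSpace H₁]

/-- The kernel of the projection is a closed invariant subspace containing `H₁`, hence the whole
space by cyclicity. -/
theorem spectralProjection_eq_zero_of_inclusionSnd {A₀ : H₀ →L[ℂ] H₀} {A₁ : H₁ →L[ℂ] H₁}
    {V : H₁ →L[ℂ] H₀} (hV : IsCyclicGenerating A₀ (LinearMap.range (V : H₁ →ₗ[ℂ] H₀)))
    (hB : IsSelfAdjoint (blockOperator A₀ A₁ V)) {Δ : Set ℝ} (hΔ : MeasurableSet Δ)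
    (h : ∀ y, spectralProjection hB Δ (inclusionSnd H₀ H₁ y) = 0) :
    spectralProjection hB Δ = 0 := by
  have key : (spectralProjection hB Δ).ker = ⊤ :=
    eq_top_of_blockOperator_invariant hV (spectralProjection hB Δ).isClosed_ker h
      fun x hx => spectralProjection_apply_apply_eq_zero hB hΔ hx
  ext1 x
  have hx : x ∈ (spectralProjection hB Δ).ker := key ▸ Submodule.mem_top
  exact hx

variable [FiniteDimensional ℂ H₁]

/-- Moving `J*` to the other side of the inner product turns the trace into diagonal matrix elements
of the resolvent, each governed by one scalar spectral measure. -/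
theorem traceResolvent_eq_sum (B : WithLp 2 (H₀ × H₁) →L[ℂ] WithLp 2 (H₀ × H₁)) (z : ℂ) :
    traceResolvent B z = ∑ i, ⟪inclusionSnd H₀ H₁ (stdOrthonormalBasis ℂ H₁ i),
      Ring.inverse (B - z • 1) (inclusionSnd H₀ H₁ (stdOrthonormalBasis ℂ H₁ i))⟫_ℂ := by
  rw [traceResolvent, LinearMap.trace_eq_sum_inner _ (stdOrthonormalBasis ℂ H₁)]
  refine Finset.sum_congr rfl fun i _ => ?_
  exact ContinuousLinearMap.adjoint_inner_right (inclusionSnd H₀ H₁) _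
    (Ring.inverse (B - z • (1 : WithLp 2 (H₀ × H₁) →L[ℂ] WithLp 2 (H₀ × H₁)))
      (inclusionSnd H₀ H₁ (stdOrthonormalBasis ℂ H₁ i)))

theorem isScalarHerglotz_traceResolvent {B : WithLp 2 (H₀ × H₁) →L[ℂ] WithLp 2 (H₀ × H₁)}
    (hB : IsSelfAdjoint B) : IsScalarHerglotz (traceResolvent B) := by
  refine ⟨fun z hz => DifferentiableAt.differentiableWithinAt ?_, fun z hz => ?_⟩
  · rw [funext (traceResolvent_eq_sum B)]
    exact DifferentiableAt.fun_sum fun i _ =>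
      differentiableAt_inner_inverse_sub_smul_one hB hz _ _
  · rw [traceResolvent_eq_sum, Complex.im_sum]
    exact Finset.sum_nonneg fun i _ => im_inner_inverse_sub_smul_one_nonneg hB hz _

end BlockOperatorLemmas

/-! ### Assembly of the measure `ω`. -/

theorem mainTheorem5
    {H₀ H₁ : Type*}
    [NormedAddCommGroup H₀] [InnerProductSpace ℂ H₀] [CompleteSpace H₀]
    [NormedAddCommGroup H₁] [InnerProductSpace ℂ H₁] [CompleteSpace H₁] [FiniteDimensional ℂ H₁]
    (A₀ : H₀ →L[ℂ] H₀) (hA₀ : IsSelfAdjoint A₀)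
    (A₁ : H₁ →L[ℂ] H₁) (hA₁ : IsSelfAdjoint A₁)
    (V : H₁ →L[ℂ] H₀)
    (hV : IsCyclicGenerating A₀ (LinearMap.range (V : H₁ →ₗ[ℂ] H₀))) :
    IsScalarHerglotz (traceResolvent (blockOperator A₀ A₁ V)) ∧
    ∃ ω : Measure ℝ, IsFiniteMeasure ω ∧
      (∃ K : Set ℝ, IsCompact K ∧ ω Kᶜ = 0) ∧
      (∀ z : ℂ, 0 < z.im →
        Integrable (fun t : ℝ => 1 / ((t : ℂ) - z)) ω ∧
        traceResolvent (blockOperator A₀ A₁ V) z = ∫ t : ℝ, 1 / ((t : ℂ) - z) ∂ω) ∧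
      ∀ Δ : Set ℝ, MeasurableSet Δ →
        (ω Δ = 0 ↔
          (spectralMeasure (isSelfAdjoint_blockOperator hA₀ hA₁ V)).toFun Δ = 0) := by
  have hB := isSelfAdjoint_blockOperator hA₀ hA₁ V
  let b := stdOrthonormalBasis ℂ H₁
  let e := fun i => inclusionSnd H₀ H₁ (b i)
  refine ⟨isScalarHerglotz_traceResolvent hB, ∑ i, scalarSpectralMeasure hB (e i), inferInstance,
    ⟨spectrum ℝ (blockOperator A₀ A₁ V), isCompact_iff_compactSpace.2 inferInstance, ?_⟩,
    fun z hz => ?_, fun Δ hΔ => ?_⟩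
  · rw [Measure.finsetSum_apply]
    exact Finset.sum_eq_zero fun i _ => scalarSpectralMeasure_compl_spectrum hB (e i)
  · have hint := fun i (_ : i ∈ Finset.univ) =>
      integrable_one_div_sub_scalarSpectralMeasure hB hz (e i)
    refine ⟨integrable_finsetSum_measure.2 hint, ?_⟩
    rw [integral_finsetSum_measure hint, traceResolvent_eq_sum]
    exact Finset.sum_congr rfl fun i _ => inner_inverse_sub_smul_one hB hz (e i)
  · change _ ↔ spectralProjection hB Δ = 0
    rw [Measure.finsetSum_apply, Finset.sum_eq_zero_iff]
    simp only [← spectralProjection_apply_eq_zero_iff hB hΔ]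
    refine ⟨fun h => ?_, fun h i _ => by rw [h]; rfl⟩
    refine spectralProjection_eq_zero_of_inclusionSnd hV hB hΔ fun y => ?_
    -- Vanishing on the basis vectors extends to all of `H₁` by linearity.
    rw [← b.sum_repr y]
    simp only [map_sum, map_smul]
    exact Finset.sum_eq_zero fun i hi => by rw [h i hi, smul_zero]
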